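/- Let $d\ge 2$ and consider the family of polynomial maps $$f_a(x)=-x+\sum_{j=2}^{d}a_jx^j,\qquad a=(a_2,\dots,a_d)\in\mathbb R^{d-1}.$$ For $j\ge 3$ let $W_j\in\mathbb R[a_2,\dots,a_d]$ be the coefficient of $x^j$ in $f_a(f_a(x))$ (so $W_j=0$ for $j>d^2$), and let $V_j\in\mathbb R[a_2,\dots,a_d]$ be any polynomials with $V_j-W_j\in\langle W_3,\dots,W_{j-1}\rangle$ (for instance $V_j=W_j$, or the normal form of $W_j$ modulo a Gröbner basis of $\langle W_3,\dots,W_{j-1}\rangle$). The origin is called a *weak fixed point of order $m\ge0$* of $f_a$ if $V_3(a)=V_5(a)=\cdots=V_{2m+1}(a)=0$ and $V_{2m+3}(a)\neq0$. A *2-periodic orbit* of $f$ is a set $\{x,y\}$ with $x\ne y$, $f(x)=y$, $f(y)=x$; it is *isolated* if some neighbourhood of it meets no other 2-periodic orbit. The map $f_{a^*}$ has *cyclicity* $N\in\mathbb N\cup\{0\}$ if (i) there are $\varepsilon_0,\delta_0>0$ such that the maximum, over $\|a-a^*\|<\varepsilon_0$, of the number of isolated 2-periodic orbits of $f_a$ contained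 in $(-\delta_0,\delta_0)$ is $N$; and (ii) for all $\varepsilon,\delta>0$ there is $a$ with $\|a-a^*\|<\varepsilon$ such that $f_a$ has $N$ different isolated 2-periodic orbits contained in $(-\delta,\delta)$. Assume that there is a $k$ such that for every $j$ with $3\le j\le d^2$ some power $W_j^{n_j}$, $n_j\ge1$, lies in the ideal $\langle V_3,V_5,\dots,V_{2k+1}\rangle$, and let $\ell$ be the least such $k$. Then the highest possible order of the origin as a weak fixed point is $\ell-1$, in the sense of an upper bound: for every $a\neq0$ the origin is a weak fixed point of $f_a$ of some order, and whenever the origin is a weak fixed point of $f_a$, its order is at most $\ell-1$. Moreover, for every $a\ne 0$ the cyclicity of $f_a$ exists and is at most $\ell-1$. -/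

import Mathlib

noncomputable section

/-- The parameter space `ℝ^(d-1)` of coefficient vectors `a = (a_2, …, a_d)`,
with its Euclidean norm. -/
abbrev ParamSpace (d : ℕ) : Type := EuclideanSpace ℝ (Finset.Icc 2 d)

/-- The polynomial map `f_a(x) = -x + ∑_{j=2}^d a_j x^j`. -/
def polyMap (d : ℕ) (a : ParamSpace d) (x : ℝ) : ℝ :=
  -x + ∑ j : Finset.Icc 2 d, a j * x ^ (j : ℕ)

/-- The map `f_a` with indeterminate coefficients: `-x + ∑_{j=2}^d a_j x^j` as a polynomial in `x`
over the polynomial ring `ℝ[a_2, …, a_d]`. -/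
def genericMap (d : ℕ) : Polynomial (MvPolynomial (Finset.Icc 2 d) ℝ) :=
  -Polynomial.X +
    ∑ j : Finset.Icc 2 d, Polynomial.C (MvPolynomial.X j) * Polynomial.X ^ (j : ℕ)

/-- `W_j ∈ ℝ[a_2, …, a_d]`: the coefficient of `x^j` in `f_a(f_a(x))`. -/
def stabW (d j : ℕ) : MvPolynomial (Finset.Icc 2 d) ℝ :=
  ((genericMap d).comp (genericMap d)).coeff j

/-- `V_3, V_4, …` are valid expressions of the stability constants: each `V_j` has the form
`W_j + U` with `U` in the ideal generated by `W_3, …, W_{j-1}`. Both the `W_j` themselves and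
their normal forms modulo a Gröbner basis of that ideal (the reduced stability constants) are of
this form. -/
def IsStabilityConstants (d : ℕ) (V : ℕ → MvPolynomial (Finset.Icc 2 d) ℝ) : Prop :=
  ∀ j, 3 ≤ j → V j - stabW d j ∈ Ideal.span (stabW d '' Set.Ico 3 j)

/-- The ideal `⟨V_3, V_5, …, V_{2k+1}⟩`. -/
def oddIdeal {d : ℕ} (V : ℕ → MvPolynomial (Finset.Icc 2 d) ℝ) (k : ℕ) :
    Ideal (MvPolynomial (Finset.Icc 2 d) ℝ) :=
  Ideal.span ((fun i => V (2 * i + 1)) '' Set.Icc 1 k)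

/-- The origin is a weak fixed point of order `m` of `f_a`:
`V_3(a) = V_5(a) = ⋯ = V_{2m+1}(a) = 0` and `V_{2m+3}(a) ≠ 0`. -/
def IsWeakFixedPointOfOrder {d : ℕ} (V : ℕ → MvPolynomial (Finset.Icc 2 d) ℝ)
    (a : ParamSpace d) (m : ℕ) : Prop :=
  (∀ i, 1 ≤ i → i ≤ m → MvPolynomial.eval (fun j => a j) (V (2 * i + 1)) = 0) ∧
    MvPolynomial.eval (fun j => a j) (V (2 * m + 3)) ≠ 0

/-- `O = {x, y}` with `f x = y`, `f y = x` and `x ≠ y`. -/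
def IsTwoPeriodicOrbit (f : ℝ → ℝ) (O : Set ℝ) : Prop :=
  ∃ x y : ℝ, x ≠ y ∧ f x = y ∧ f y = x ∧ O = {x, y}

/-- A 2-periodic orbit is isolated if some neighbourhood of it meets no other 2-periodic orbit. -/
def IsIsolatedTwoPeriodicOrbit (f : ℝ → ℝ) (O : Set ℝ) : Prop :=
  IsTwoPeriodicOrbit f O ∧ ∃ U : Set ℝ, IsOpen U ∧ O ⊆ U ∧
    ∀ O' : Set ℝ, IsTwoPeriodicOrbit f O' → (O' ∩ U).Nonempty → O' = O

/-- The number of isolated 2-periodic orbits of `f` contained in `(-δ, δ)`. -/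
def numIsolatedOrbits (f : ℝ → ℝ) (δ : ℝ) : ℕ∞ :=
  Set.encard {O : Set ℝ | IsIsolatedTwoPeriodicOrbit f O ∧ O ⊆ Metric.ball 0 δ}

/-- The origin of the map `f_{a₀}` of the family `f` has 2-cyclicity `N`:
(i) for suitable `ε₀, δ₀ > 0`, the maximum number of isolated 2-periodic orbits in `D_{δ₀}(0)` of
the maps `f_a`, `a ∈ D_{ε₀}(a₀)`, is `N`;
(ii) for all `ε, δ > 0` some `f_a` with `a ∈ D_ε(a₀)` has `N` different isolated 2-periodic orbits
in `D_δ(0)`. -/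
def HasTwoCyclicity {P : Type*} [PseudoMetricSpace P] (f : P → ℝ → ℝ) (a₀ : P) (N : ℕ) : Prop :=
  (∃ ε₀ > (0 : ℝ), ∃ δ₀ > (0 : ℝ),
    IsGreatest ((fun a => numIsolatedOrbits (f a) δ₀) '' Metric.ball a₀ ε₀) (N : ℕ∞)) ∧
  ∀ ε > (0 : ℝ), ∀ δ > (0 : ℝ), ∃ a ∈ Metric.ball a₀ ε, (N : ℕ∞) ≤ numIsolatedOrbits (f a) δ

end

/-!
Since `f_a(x) = -x + O(x²)` commutes with `f_a ∘ f_a`, the lowest-order term of `f_a(f_a(x)) - x`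
has odd degree at least three (`odd_of_leading_coeff_comp_self`). Together with
`V_j ≡ W_j mod ⟨W_3, …, W_{j-1}⟩` this shows that the origin is a weak fixed point of order `m`
exactly when `W_{2m+3}` is the first `W_j` not vanishing at `a` (`isWeakFixedPointOfOrder_iff`).

*Orders.* If `a ≠ 0`, then `f_a ∘ f_a` has degree greater than one, so some `W_j(a)` is nonzero and
an order exists. If the order were at least `ℓ`, then all of `V_3, V_5, …, V_{2ℓ+1}` would vanish
at `a`, hence so would powers of all `W_j`, hence all `W_j`
(`IsWeakFixedPointOfOrder.lt_of_pow_mem_oddIdeal`).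

*Cyclicity.* Let the origin have order `m` at `a ≠ 0`. For every `b` the polynomial
`f_b(f_b(x)) - x` is divisible by `x³`; the `2m`-th derivative of the quotient is continuous in
`(b, x)` and equals `(2m)! W_{2m+3}(a) ≠ 0` at `(a, 0)`. By Rolle's theorem the quotient has at most
`2m` zeros near the origin for `b` near `a`. A two-periodic orbit uses up two of them, so there are
at most `m ≤ ℓ - 1` such orbits (`IsWeakFixedPointOfOrder.exists_numIsolatedOrbits_le`). Given such
a local bound, the cyclicity exists, as the least local bound (`exists_hasTwoCyclicity`).
-/

open Polynomial

/-! ### The leading coefficient of the second iterate -/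

/-- If `f(x) = -x + O(x²)` and `f(f(x)) = x + c xⁿ + O(xⁿ⁺¹)` with `c ≠ 0` and `n ≥ 1`, then `n` is
odd: the coefficients of `xⁿ` in `f ∘ (f ∘ f) - f` and `(f ∘ f) ∘ f - f` are `-c` and
`(-1)ⁿ c`. -/
lemma odd_of_leading_coeff_comp_self {f : ℝ[X]} (h0 : f.coeff 0 = 0) (h1 : f.coeff 1 = -1)
    {n : ℕ} (hn : 1 ≤ n) (hlow : ∀ i < n, (f.comp f - X).coeff i = 0)
    (hc : (f.comp f - X).coeff n ≠ 0) : Odd n := by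
  obtain ⟨q, hq⟩ := X_pow_dvd_iff.mpr hlow
  have hg : f.comp f = X + X ^ n * q := by rw [← hq]; ring
  have hcq : (f.comp f - X).coeff n = q.coeff 0 := by
    rw [hq, coeff_X_pow_mul', if_pos le_rfl, Nat.sub_self]
  obtain ⟨k, hk⟩ := (f.map C).binomExpansion X (X ^ n * q)
  have hleft : f.comp (f.comp f) = f + derivative f * (X ^ n * q) + k * (X ^ n * q) ^ 2 := by
    have e : ∀ p r : ℝ[X], (p.map C).eval r = p.comp r := fun p r => by rw [eval_map]; rfl
    rw [derivative_map, e, e, e, comp_X, comp_X] at hk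
    rw [← hk, ← hg]
  have hright : (f.comp f).comp f = f + f ^ n * q.comp f := by
    conv_lhs => rw [hg]
    simp
  obtain ⟨s, hs⟩ := X_dvd_iff.mpr h0
  have hs0 : s.coeff 0 = -1 := by
    rw [← h1, hs, coeff_X_mul]
  have e1 : (derivative f * (X ^ n * q)).coeff n = -q.coeff 0 := by
    rw [show derivative f * (X ^ n * q) = X ^ n * (derivative f * q) by ring,
      coeff_X_pow_mul', if_pos le_rfl, Nat.sub_self, mul_coeff_zero, coeff_derivative, h1]
    simp
  have e2 : (k * (X ^ n * q) ^ 2).coeff n = 0 := by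
    rw [show k * (X ^ n * q) ^ 2 = X ^ (n + n) * (k * q ^ 2) by ring, coeff_X_pow_mul',
      if_neg (by omega)]
  have e3 : (f ^ n * q.comp f).coeff n = (-1) ^ n * q.coeff 0 := by
    have : f ^ n * q.comp f = X ^ n * (s ^ n * q.comp f) := by
      conv_lhs => rw [show f ^ n = (X * s) ^ n by rw [← hs]]
      ring
    rw [this, coeff_X_pow_mul', if_pos le_rfl, Nat.sub_self, mul_coeff_zero,
      coeff_zero_eq_eval_zero, eval_pow, ← coeff_zero_eq_eval_zero, hs0,
      coeff_zero_eq_eval_zero, eval_comp, ← coeff_zero_eq_eval_zero, h0,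
      ← coeff_zero_eq_eval_zero]
  have key : -q.coeff 0 = (-1) ^ n * q.coeff 0 := by
    have := congrArg (fun p => p.coeff n) (hleft.symm.trans ((comp_assoc f f f).symm.trans hright))
    simp only [coeff_add, e1, e2, e3] at this
    linarith
  rw [hcq] at hc
  by_contra hodd
  rw [(Nat.not_odd_iff_even.mp hodd).neg_one_pow] at key
  exact hc (by linarith)

/-! ### The stability constants at a parameter -/

/-- The map `f_a` as a real polynomial. -/
noncomputable def realMap (d : ℕ) (a : ParamSpace d) : ℝ[X] :=
  (genericMap d).map (MvPolynomial.eval (fun j => a j))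

lemma realMap_eq (d : ℕ) (a : ParamSpace d) :
    realMap d a = -X + ∑ j : Finset.Icc 2 d, C (a j) * X ^ (j : ℕ) := by
  simp [realMap, genericMap, Polynomial.map_sum]

lemma eval_realMap (d : ℕ) (a : ParamSpace d) (x : ℝ) :
    (realMap d a).eval x = polyMap d a x := by
  simp [realMap_eq, polyMap, eval_finsetSum]

lemma coeff_realMap (d : ℕ) (a : ParamSpace d) (i : ℕ) (hi : i < 2) :
    (realMap d a).coeff i = (-X : ℝ[X]).coeff i := by
  rw [realMap_eq, coeff_add, finsetSum_coeff, Finset.sum_eq_zero, add_zero]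
  intro j _
  have := (Finset.mem_Icc.mp j.2).1
  rw [coeff_C_mul, coeff_X_pow, if_neg (by omega), mul_zero]

lemma coeff_zero_realMap (d : ℕ) (a : ParamSpace d) : (realMap d a).coeff 0 = 0 := by
  simp [coeff_realMap]

lemma coeff_one_realMap (d : ℕ) (a : ParamSpace d) : (realMap d a).coeff 1 = -1 := by
  simp [coeff_realMap]

lemma coeff_realMap_index (d : ℕ) (a : ParamSpace d) (i : Finset.Icc 2 d) :
    (realMap d a).coeff i = a i := by
  have := (Finset.mem_Icc.mp i.2).1
  rw [realMap_eq, coeff_add, finsetSum_coeff, Finset.sum_eq_single i]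
  · simp [coeff_X, show (1 : ℕ) ≠ i by omega]
  · intro j _ hji
    rw [coeff_C_mul, coeff_X_pow, if_neg (fun h => hji (Subtype.ext h.symm)), mul_zero]
  · simp

lemma eval_stabW (d j : ℕ) (a : ParamSpace d) :
    MvPolynomial.eval (fun i => a i) (stabW d j) = ((realMap d a).comp (realMap d a)).coeff j := by
  rw [stabW, realMap, ← Polynomial.map_comp, coeff_map]

lemma stabW_eq_zero_of_lt {d j : ℕ} (hd : 2 ≤ d) (hj : d ^ 2 < j) : stabW d j = 0 := by
  have hdeg : (genericMap d).natDegree ≤ d := by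
    unfold genericMap
    refine natDegree_add_le_of_degree_le ?_ (natDegree_sum_le_of_forall_le _ _ fun i _ => ?_)
    · rw [natDegree_neg]
      exact natDegree_X_le.trans (by omega)
    · exact (natDegree_C_mul_X_pow_le _ _).trans (Finset.mem_Icc.mp i.2).2
  refine coeff_eq_zero_of_natDegree_lt (lt_of_le_of_lt ?_ hj)
  rw [natDegree_comp, sq]
  exact Nat.mul_le_mul hdeg hdeg

/-- `f_a(f_a(x)) - x` has no terms of degree less than two. -/
lemma coeff_comp_self_sub_X_of_lt_two (d : ℕ) (a : ParamSpace d) {i : ℕ} (hi : i < 2) :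
    ((realMap d a).comp (realMap d a) - X).coeff i = 0 := by
  have h0 := coeff_zero_realMap d a
  obtain rfl | rfl : i = 0 ∨ i = 1 := by omega
  · rw [coeff_zero_eq_eval_zero, eval_sub, eval_comp, ← coeff_zero_eq_eval_zero, h0,
      ← coeff_zero_eq_eval_zero, h0, eval_X, sub_zero]
  · have h1 : (derivative (realMap d a)).eval 0 = -1 := by
      rw [← coeff_zero_eq_eval_zero, coeff_derivative, zero_add, coeff_one_realMap]
      simp
    have h2 : (derivative ((realMap d a).comp (realMap d a) - X)).eval 0 = 0 := by
      rw [derivative_sub, derivative_comp, eval_sub, eval_mul, eval_comp,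
        ← coeff_zero_eq_eval_zero (realMap d a), h0, h1, derivative_X]
      simp
    rw [← coeff_zero_eq_eval_zero, coeff_derivative] at h2
    simpa using h2

/-- The degree-two coefficient vanishes as well, since the lowest degree is odd. -/
lemma coeff_comp_self_sub_X_of_lt_three (d : ℕ) (a : ParamSpace d) {i : ℕ} (hi : i < 3) :
    ((realMap d a).comp (realMap d a) - X).coeff i = 0 := by
  rcases Nat.lt_or_ge i 2 with h2 | h2
  · exact coeff_comp_self_sub_X_of_lt_two d a h2
  · obtain rfl : i = 2 := by omega
    by_contra hc
    exact absurd (odd_of_leading_coeff_comp_self (coeff_zero_realMap d a)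
      (coeff_one_realMap d a) (by norm_num)
      (fun i hi => coeff_comp_self_sub_X_of_lt_two d a hi) hc) (by decide)

/-- For `a ≠ 0` the degree of `f_a ∘ f_a` is the square of a number greater than one, so `f_a` is
not an involution. -/
lemma realMap_comp_self_ne_X {d : ℕ} {a : ParamSpace d} (ha : a ≠ 0) :
    (realMap d a).comp (realMap d a) ≠ X := by
  intro h
  obtain ⟨i, hi⟩ : ∃ i, a i ≠ 0 := by
    by_contra! h'
    exact ha (by ext i; simpa using h' i)
  have hi2 := (Finset.mem_Icc.mp i.2).1
  have hdeg : 2 ≤ (realMap d a).natDegree :=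
    hi2.trans (le_natDegree_of_ne_zero (by rwa [coeff_realMap_index]))
  have := congrArg natDegree h
  rw [natDegree_comp, natDegree_X] at this
  nlinarith

/-- The lowest-order term of `f_a(f_a(x)) - x` has odd degree at least three. -/
lemma exists_first_nonzero_stabW {d : ℕ} {a : ParamSpace d} {j : ℕ} (hj : 3 ≤ j)
    (hne : MvPolynomial.eval (fun i => a i) (stabW d j) ≠ 0) :
    ∃ m, 2 * m + 3 ≤ j ∧ (∀ i, 3 ≤ i → i < 2 * m + 3 →
      MvPolynomial.eval (fun i => a i) (stabW d i) = 0) ∧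
      MvPolynomial.eval (fun i => a i) (stabW d (2 * m + 3)) ≠ 0 := by
  classical
  have hW : ∀ i, 2 ≤ i → MvPolynomial.eval (fun i => a i) (stabW d i) =
      ((realMap d a).comp (realMap d a) - X).coeff i := by
    intro i hi
    rw [eval_stabW, coeff_sub, coeff_X, if_neg (by omega), sub_zero]
  have hex : ∃ n, ((realMap d a).comp (realMap d a) - X).coeff n ≠ 0 :=
    ⟨j, by rwa [← hW j (by omega)]⟩
  obtain ⟨n, hn, hmin⟩ : ∃ n, ((realMap d a).comp (realMap d a) - X).coeff n ≠ 0 ∧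
      ∀ i < n, ((realMap d a).comp (realMap d a) - X).coeff i = 0 :=
    ⟨Nat.find hex, Nat.find_spec hex, fun i hi => not_not.mp (Nat.find_min hex hi)⟩
  have hn2 : 2 ≤ n := by
    by_contra! h
    exact hn (coeff_comp_self_sub_X_of_lt_two d a h)
  obtain ⟨k, hk⟩ := odd_of_leading_coeff_comp_self (coeff_zero_realMap d a)
    (coeff_one_realMap d a) (by omega) hmin hn
  have hnj : n ≤ j := by
    by_contra! h
    exact hne (by rw [hW j (by omega), hmin j h])
  obtain rfl : n = 2 * (k - 1) + 3 := by omega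
  exact ⟨k - 1, hnj, fun i hi hi' => by rw [hW i (by omega), hmin i hi'],
    by rwa [hW _ (by omega)]⟩

/-- Where `W_3, …, W_{j-1}` vanish, `V_j` and `W_j` take the same value. -/
lemma eval_eq_eval_stabW {d : ℕ} {V : ℕ → MvPolynomial (Finset.Icc 2 d) ℝ}
    (hV : IsStabilityConstants d V) {a : ParamSpace d} {j : ℕ} (hj : 3 ≤ j)
    (h : ∀ i, 3 ≤ i → i < j → MvPolynomial.eval (fun i => a i) (stabW d i) = 0) :
    MvPolynomial.eval (fun i => a i) (V j) = MvPolynomial.eval (fun i => a i) (stabW d j) := by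
  have hle : Ideal.span (stabW d '' Set.Ico 3 j) ≤
      RingHom.ker (MvPolynomial.eval (fun i => a i)) := by
    rw [Ideal.span_le]
    rintro _ ⟨i, hi, rfl⟩
    exact h i hi.1 hi.2
  have := hle (hV j hj)
  rwa [RingHom.mem_ker, map_sub, sub_eq_zero] at this

/-- The order of a weak fixed point is read off the first non-vanishing `W_j`, whichever stability
constants `V` are used. -/
lemma isWeakFixedPointOfOrder_iff {d : ℕ} {V : ℕ → MvPolynomial (Finset.Icc 2 d) ℝ}
    (hV : IsStabilityConstants d V) (a : ParamSpace d) (m : ℕ) :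
    IsWeakFixedPointOfOrder V a m ↔
      (∀ i, 3 ≤ i → i < 2 * m + 3 → MvPolynomial.eval (fun i => a i) (stabW d i) = 0) ∧
        MvPolynomial.eval (fun i => a i) (stabW d (2 * m + 3)) ≠ 0 := by
  constructor
  · rintro ⟨hz, hne⟩
    have hlow : ∀ i, 3 ≤ i → i < 2 * m + 3 →
        MvPolynomial.eval (fun i => a i) (stabW d i) = 0 := by
      intro i hi hi'
      by_contra h
      obtain ⟨n, hni, hn0, hn⟩ := exists_first_nonzero_stabW hi h
      apply hn
      rw [← eval_eq_eval_stabW hV (by omega) hn0]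
      exact hz (n + 1) (by omega) (by omega)
    exact ⟨hlow, by rwa [← eval_eq_eval_stabW hV (by omega) hlow]⟩
  · rintro ⟨hz, hne⟩
    refine ⟨fun i hi hi' => ?_, by rwa [eval_eq_eval_stabW hV (by omega) hz]⟩
    rw [eval_eq_eval_stabW hV (by omega) fun k hk hk' => hz k hk (by omega)]
    exact hz _ (by omega) (by omega)

lemma exists_isWeakFixedPointOfOrder {d : ℕ} {V : ℕ → MvPolynomial (Finset.Icc 2 d) ℝ}
    (hV : IsStabilityConstants d V) {a : ParamSpace d} (ha : a ≠ 0) :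
    ∃ m, IsWeakFixedPointOfOrder V a m := by
  obtain ⟨j, hj⟩ : ∃ j, ((realMap d a).comp (realMap d a) - X).coeff j ≠ 0 := by
    by_contra! h
    exact realMap_comp_self_ne_X ha (sub_eq_zero.mp (Polynomial.ext (by simpa using h)))
  have hj3 : 3 ≤ j := by
    by_contra! h
    exact hj (coeff_comp_self_sub_X_of_lt_three d a h)
  rw [coeff_sub, coeff_X, if_neg (by omega), sub_zero, ← eval_stabW] at hj
  obtain ⟨m, -, hm⟩ := exists_first_nonzero_stabW hj3 hj
  exact ⟨m, (isWeakFixedPointOfOrder_iff hV a m).mpr hm⟩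

lemma IsWeakFixedPointOfOrder.lt_of_pow_mem_oddIdeal {d : ℕ} (hd : 2 ≤ d)
    {V : ℕ → MvPolynomial (Finset.Icc 2 d) ℝ} (hV : IsStabilityConstants d V) {k : ℕ}
    (hk : ∀ j, 3 ≤ j → j ≤ d ^ 2 → ∃ n : ℕ, 0 < n ∧ stabW d j ^ n ∈ oddIdeal V k)
    {a : ParamSpace d} {m : ℕ} (h : IsWeakFixedPointOfOrder V a m) : m < k := by
  by_contra! hkm
  apply ((isWeakFixedPointOfOrder_iff hV a m).mp h).2
  rcases le_or_gt (2 * m + 3) (d ^ 2) with hle | hlt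
  · obtain ⟨n, hn, hmem⟩ := hk (2 * m + 3) (by omega) hle
    have hker : oddIdeal V k ≤ RingHom.ker (MvPolynomial.eval (fun i => a i)) := by
      rw [oddIdeal, Ideal.span_le]
      rintro _ ⟨i, hi, rfl⟩
      exact h.1 i hi.1 (hi.2.trans hkm)
    have := hker hmem
    rw [RingHom.mem_ker, map_pow] at this
    exact (pow_eq_zero_iff hn.ne').mp this
  · rw [stabW_eq_zero_of_lt hd hlt, map_zero]

/-! ### Counting the periodic orbits near the origin -/

/-- Iterated Rolle theorem: if the `n`-th derivative of a polynomial has no zero in an interval, the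
polynomial has at most `n` zeros there. -/
lemma card_le_of_iterate_derivative_ne_zero {s : Set ℝ} (hs : s.OrdConnected) (n : ℕ) (p : ℝ[X])
    (hp : ∀ x ∈ s, (derivative^[n] p).eval x ≠ 0) (Z : Finset ℝ)
    (hZ : ∀ x ∈ Z, x ∈ s ∧ p.eval x = 0) : Z.card ≤ n := by
  classical
  induction n generalizing p Z with
  | zero =>
    rw [Nat.le_zero, Finset.card_eq_zero, Finset.eq_empty_iff_forall_notMem]
    exact fun x hx => hp x (hZ x hx).1 (hZ x hx).2
  | succ n ih =>
    rcases Z.eq_empty_or_nonempty with rfl | ⟨x₀, hx₀⟩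
    · simp
    have hp' : derivative p ≠ 0 := by
      intro h
      apply hp x₀ (hZ x₀ hx₀).1
      rw [Function.iterate_succ_apply, h, iterate_derivative_zero, eval_zero]
    refine (Finset.card_le_of_interleaved
      (t := (derivative p).roots.toFinset.filter (· ∈ s)) fun x hx y hy hxy _ => ?_).trans
      (Nat.succ_le_succ (ih (derivative p) hp _ fun x hx => ?_))
    · obtain ⟨z, hz, hz'⟩ := exists_deriv_eq_zero hxy p.continuousOn
        ((hZ x hx).2.trans (hZ y hy).2.symm)
      refine ⟨z, ?_, hz.1, hz.2⟩
      rw [Polynomial.deriv] at hz'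
      simp only [Finset.mem_filter, Multiset.mem_toFinset, mem_roots hp', IsRoot.def]
      exact ⟨hz', hs.out (hZ x hx).1 (hZ y hy).1 ⟨hz.1.le, hz.2.le⟩⟩
    · simp only [Finset.mem_filter, Multiset.mem_toFinset, mem_roots hp', IsRoot.def] at hx
      exact ⟨hx.2, hx.1⟩

lemma continuous_eval_map_eval {σ : Type*} (p : Polynomial (MvPolynomial σ ℝ)) :
    Continuous fun z : (σ → ℝ) × ℝ => (p.map (MvPolynomial.eval z.1)).eval z.2 := by
  simp only [eval_map, eval₂_eq_sum, Polynomial.sum]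
  refine continuous_finsetSum _ fun i _ => ?_
  exact ((MvPolynomial.continuous_eval _).comp continuous_fst).mul (continuous_snd.pow i)

lemma IsTwoPeriodicOrbit.eq_pair {f : ℝ → ℝ} {O : Set ℝ} (hO : IsTwoPeriodicOrbit f O) {x : ℝ}
    (hx : x ∈ O) : O = {x, f x} := by
  obtain ⟨u, v, -, huv, hvu, rfl⟩ := hO
  rcases hx with rfl | rfl
  · rw [huv]
  · rw [hvu, Set.pair_comm]

/-- If `f ∘ f` has at most `2m` fixed points in `(-δ, δ)` that `f` does not fix, there are at most
`m` two-periodic orbits there, because distinct orbits are disjoint. -/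
lemma numIsolatedOrbits_le {f : ℝ → ℝ} {δ : ℝ} {m : ℕ}
    (h : ∀ Z : Finset ℝ, (∀ x ∈ Z, x ∈ Metric.ball 0 δ ∧ f x ≠ x ∧ f (f x) = x) →
      Z.card ≤ 2 * m) : numIsolatedOrbits f δ ≤ m := by
  classical
  by_contra! hlt
  obtain ⟨T, hT, hTc⟩ := Set.exists_subset_encard_eq
    (k := ((m + 1 : ℕ) : ℕ∞)) (by
      rw [Nat.cast_add, Nat.cast_one]
      exact Order.add_one_le_of_lt hlt :
        _ ≤ {O : Set ℝ | IsIsolatedTwoPeriodicOrbit f O ∧ O ⊆ Metric.ball 0 δ}.encard)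
  have hfin : T.Finite := Set.finite_of_encard_eq_coe hTc
  lift T to Finset (Set ℝ) using hfin
  rw [Set.encard_coe_eq_coe_finsetCard, Nat.cast_inj] at hTc
  have hex : ∀ O : Set ℝ, ∃ x y : ℝ, O ∈ T → x ≠ y ∧ f x = y ∧ f y = x ∧ O = {x, y} := by
    intro O
    by_cases hO : O ∈ T
    · obtain ⟨x, y, hxy⟩ := (hT hO).1.1
      exact ⟨x, y, fun _ => hxy⟩
    · exact ⟨0, 0, fun h => absurd h hO⟩
  choose x y hxy using hex
  have hmem : ∀ O ∈ T, ∀ z, z ∈ ({x O, y O} : Finset ℝ) ↔ z ∈ O := by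
    intro O hO z
    conv_rhs => rw [(hxy O hO).2.2.2]
    simp
  have hcard : (T.biUnion fun O => {x O, y O}).card = 2 * (m + 1) := by
    rw [Finset.card_biUnion, Finset.sum_congr rfl fun O hO => Finset.card_pair (hxy O hO).1,
      Finset.sum_const, hTc, smul_eq_mul, mul_comm]
    intro O hO O' hO' hne
    rw [Function.onFun, Finset.disjoint_left]
    intro z hz hz'
    rw [hmem O hO] at hz
    rw [hmem O' hO'] at hz'
    exact hne (((hT hO).1.1.eq_pair hz).trans ((hT hO').1.1.eq_pair hz').symm)
  have := h (T.biUnion fun O => {x O, y O}) fun z hz => by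
    obtain ⟨O, hO, hzO⟩ := Finset.mem_biUnion.mp hz
    refine ⟨(hT hO).2 ((hmem O hO z).mp hzO), ?_⟩
    obtain ⟨h1, h2, h3, -⟩ := hxy O hO
    rcases Finset.mem_insert.mp hzO with rfl | hz'
    · rw [h2]; exact ⟨h1.symm, h3⟩
    · obtain rfl := Finset.mem_singleton.mp hz'
      rw [h3]; exact ⟨h1, h2⟩
  omega

/-- Near a map whose origin is a weak fixed point of order `m`, all maps of the family have at most
`m` two-periodic orbits close to the origin: the `2m`-th derivative of
`(f_a(f_a(x)) - x) / x³` does not vanish there. -/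
lemma IsWeakFixedPointOfOrder.exists_numIsolatedOrbits_le {d : ℕ}
    {V : ℕ → MvPolynomial (Finset.Icc 2 d) ℝ} (hV : IsStabilityConstants d V)
    {a : ParamSpace d} {m : ℕ} (hm : IsWeakFixedPointOfOrder V a m) :
    ∃ r > (0 : ℝ), ∀ b ∈ Metric.ball a r, numIsolatedOrbits (polyMap d b) r ≤ m := by
  have hne := ((isWeakFixedPointOfOrder_iff hV a m).mp hm).2
  set H : Polynomial (MvPolynomial (Finset.Icc 2 d) ℝ) :=
    ((genericMap d).comp (genericMap d) - X).divX.divX.divX with hH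
  have hcont : Continuous fun z : ParamSpace d × ℝ =>
      ((derivative^[2 * m] H).map (MvPolynomial.eval (fun j => z.1 j))).eval z.2 :=
    (continuous_eval_map_eval (derivative^[2 * m] H)).comp
      (((PiLp.continuous_ofLp 2 _).comp continuous_fst).prodMk continuous_snd)
  have hat : ((derivative^[2 * m] H).map (MvPolynomial.eval (fun j => a j))).eval 0 ≠ 0 := by
    rw [← coeff_zero_eq_eval_zero, coeff_map, coeff_iterate_derivative, hH, coeff_divX, coeff_divX,
      coeff_divX, coeff_sub, coeff_X, if_neg (by omega), sub_zero, map_nsmul, nsmul_eq_mul]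
    refine mul_ne_zero ?_ ?_
    · rw [zero_add, Nat.descFactorial_self]
      exact_mod_cast Nat.factorial_ne_zero _
    · rw [zero_add]; exact hne
  obtain ⟨r, hr, hball⟩ := Metric.isOpen_iff.mp (isOpen_ne_fun hcont continuous_const) (a, 0) hat
  refine ⟨r, hr, fun b hb => numIsolatedOrbits_le fun Z hZ => ?_⟩
  have hs : (Metric.ball (0 : ℝ) r).OrdConnected := (convex_ball 0 r).ordConnected
  refine card_le_of_iterate_derivative_ne_zero hs (2 * m)
    (H.map (MvPolynomial.eval (fun j => b j))) (fun x hx => ?_) Z fun x hx => ?_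
  · rw [iterate_derivative_map]
    exact hball (show (b, x) ∈ Metric.ball (a, (0 : ℝ)) r by
      rw [← ball_prod_same]; exact ⟨hb, hx⟩)
  obtain ⟨hxr, hfix, hper⟩ := hZ x hx
  refine ⟨hxr, ?_⟩
  have hx0 : x ≠ 0 := by
    rintro rfl
    apply hfix
    rw [← eval_realMap, ← coeff_zero_eq_eval_zero, coeff_zero_realMap]
  have hfac : (realMap d b).comp (realMap d b) - X =
      H.map (MvPolynomial.eval (fun j => b j)) * X ^ 3 := by
    ext i
    rw [coeff_mul_X_pow']
    split_ifs with hi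
    · obtain ⟨k, rfl⟩ := Nat.exists_eq_add_of_le' hi
      rw [Nat.add_sub_cancel, coeff_map, hH, coeff_divX, coeff_divX, coeff_divX, coeff_sub,
        coeff_sub, coeff_X, coeff_X, if_neg (by omega), if_neg (by omega), sub_zero, sub_zero,
        ← eval_stabW]
      rfl
    · exact coeff_comp_self_sub_X_of_lt_three d b (by omega)
  have := congrArg (eval x) hfac
  rw [eval_sub, eval_comp, eval_realMap, eval_realMap, hper, eval_X, sub_self, eval_mul, eval_pow,
    eval_X] at this
  exact (mul_eq_zero.mp this.symm).resolve_right (pow_ne_zero 3 hx0)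

/-! ### Existence of the cyclicity -/

lemma numIsolatedOrbits_mono (f : ℝ → ℝ) {δ δ' : ℝ} (h : δ ≤ δ') :
    numIsolatedOrbits f δ ≤ numIsolatedOrbits f δ' :=
  Set.encard_le_encard fun _ hO => ⟨hO.1, hO.2.trans (Metric.ball_subset_ball h)⟩

/-- A local bound on the number of isolated two-periodic orbits makes the cyclicity exist: it is the
least number that bounds these counts in some neighbourhood of the parameter and the origin. -/
lemma exists_hasTwoCyclicity {P : Type*} [PseudoMetricSpace P] {f : P → ℝ → ℝ} {a₀ : P} {m : ℕ}
    (h : ∃ r > (0 : ℝ), ∀ a ∈ Metric.ball a₀ r, numIsolatedOrbits (f a) r ≤ m) :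
    ∃ N, HasTwoCyclicity f a₀ N := by
  classical
  have hex : ∃ n : ℕ, ∃ r > (0 : ℝ), ∀ a ∈ Metric.ball a₀ r, numIsolatedOrbits (f a) r ≤ n := ⟨m, h⟩
  obtain ⟨N, ⟨r, hr, hN⟩, hmin⟩ : ∃ N : ℕ, (∃ r > (0 : ℝ), ∀ a ∈ Metric.ball a₀ r,
      numIsolatedOrbits (f a) r ≤ N) ∧ ∀ n < N, ¬ ∃ r > (0 : ℝ), ∀ a ∈ Metric.ball a₀ r,
      numIsolatedOrbits (f a) r ≤ n :=
    ⟨Nat.find hex, Nat.find_spec hex, fun n hn => Nat.find_min hex hn⟩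
  have hattain : ∀ t > (0 : ℝ), ∃ a ∈ Metric.ball a₀ t, (N : ℕ∞) ≤ numIsolatedOrbits (f a) t := by
    intro t ht
    rcases Nat.eq_zero_or_pos N with rfl | hpos
    · exact ⟨a₀, Metric.mem_ball_self ht, by simp⟩
    by_contra! hlt
    refine hmin (N - 1) (by omega) ⟨t, ht, fun a ha => ?_⟩
    have := hlt a ha
    rw [show (N : ℕ∞) = ((N - 1 : ℕ) : ℕ∞) + 1 by
      exact_mod_cast (Nat.sub_add_cancel hpos).symm] at this
    exact Order.le_of_lt_add_one this
  refine ⟨N, ⟨r, hr, r, hr, ?_, ?_⟩, fun ε hε δ hδ => ?_⟩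
  · obtain ⟨a, ha, hle⟩ := hattain r hr
    exact ⟨a, ha, le_antisymm (hN a ha) hle⟩
  · rintro _ ⟨a, ha, rfl⟩
    exact hN a ha
  · obtain ⟨a, ha, hle⟩ := hattain (min ε δ) (lt_min hε hδ)
    exact ⟨a, Metric.ball_subset_ball (min_le_left _ _) ha,
      hle.trans (numIsolatedOrbits_mono _ (min_le_right _ _))⟩

lemma HasTwoCyclicity.le_of_numIsolatedOrbits_le {P : Type*} [PseudoMetricSpace P]
    {f : P → ℝ → ℝ} {a₀ : P} {m N : ℕ} (hN : HasTwoCyclicity f a₀ N)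
    (h : ∃ r > (0 : ℝ), ∀ a ∈ Metric.ball a₀ r, numIsolatedOrbits (f a) r ≤ m) : N ≤ m := by
  obtain ⟨r, hr, hle⟩ := h
  obtain ⟨a, ha, hNa⟩ := hN.2 r hr r hr
  exact_mod_cast hNa.trans (hle a ha)

/-! ### Bounds for the order and the cyclicity -/

theorem mainTheorem5 (d : ℕ) (hd : 2 ≤ d)
    (V : ℕ → MvPolynomial (Finset.Icc 2 d) ℝ) (hV : IsStabilityConstants d V)
    (ℓ : ℕ)
    (hℓ : IsLeast {k : ℕ | ∀ j, 3 ≤ j → j ≤ d ^ 2 →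
      ∃ n : ℕ, 0 < n ∧ stabW d j ^ n ∈ oddIdeal V k} ℓ) :
    ((∀ a : ParamSpace d, a ≠ 0 → ∃ m, IsWeakFixedPointOfOrder V a m) ∧
      (∀ (a : ParamSpace d) (m : ℕ), IsWeakFixedPointOfOrder V a m → m ≤ ℓ - 1)) ∧
    (∀ a : ParamSpace d, a ≠ 0 →
      (∃ N, HasTwoCyclicity (polyMap d) a N) ∧
      ∀ N, HasTwoCyclicity (polyMap d) a N → N ≤ ℓ - 1) := by
  refine ⟨⟨fun a ha => exists_isWeakFixedPointOfOrder hV ha,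
    fun a m h => Nat.le_sub_one_of_lt (h.lt_of_pow_mem_oddIdeal hd hV hℓ.1)⟩, fun a ha => ?_⟩
  obtain ⟨m, hm⟩ := exists_isWeakFixedPointOfOrder hV ha
  have hbound := hm.exists_numIsolatedOrbits_le hV
  exact ⟨exists_hasTwoCyclicity hbound, fun N hN =>
    (hN.le_of_numIsolatedOrbits_le hbound).trans
      (Nat.le_sub_one_of_lt (hm.lt_of_pow_mem_oddIdeal hd hV hℓ.1))⟩
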